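/- Let $1\le m\le n$ be integers. For $\xi_1,\dots,\xi_n\in\mathbb R^d$ let $C_2\big(\frac1n\sum_{i=1}^n\delta_{\xi_i},m\big)$ denote the smallest type-2 Wasserstein distance (with respect to the Euclidean norm $\|\cdot\|_2$) between the empirical distribution $\frac1n\sum_{i=1}^n\delta_{\xi_i}$ and a probability distribution supported on at most $m$ points of $\mathbb R^d$. Here the type-2 Wasserstein distance between $\sum_i p_i\delta_{\xi_i}$ and $\sum_j q_j\delta_{\zeta_j}$ is the square root of the minimum of $\sum_{i,j}\pi_{ij}\|\xi_i-\zeta_j\|_2^2$ over all nonnegative matrices $(\pi_{ij})$ with $\sum_j\pi_{ij}=p_i$ for all $i$ and $\sum_i\pi_{ij}=q_j$ for all $j$. For any $\epsilon>0$ and $\delta>0$ there exist $c>0$ and an integer $d\ge 1$ (which may depend on $n$, $m$, $\epsilon$, $\delta$) such that, if $\xi_1,\dots,\xi_n$ are sampled independently from the normal distribution on $\mathbb R^d$ with mean $0$ and covariance matrix $(\sqrt{d-1}+c)^{-2}\,\mathbb I$, then with probability at least $1-\epsilon$ both $$\|\xi_i\|_2\le 1\ \text{ for all } i\in\{1,\dots,n\}\qquad\text{and}\qquad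 C_2\Big(\frac1n\sum_{i=1}^n\delta_{\xi_i},m\Big)\ge\sqrt{1-\frac mn}-\delta .$$ -/

import Mathlib

open MeasureTheory ProbabilityTheory

/-- The objective values of the transportation problem between the discrete distributions
`∑ i, p i • δ_(ξ i)` and `∑ j, q j • δ_(ζ j)` on `ℝ^d`: the total costs
`∑ i, ∑ j, π i j * ‖ξ i - ζ j‖ ^ l` (with the 2-norm) of all the transportation plans `π`,
that is, of all the nonnegative matrices with row sums `p` and column sums `q`. -/
def transportCosts {d n m : ℕ} (l : ℝ)
    (p : Fin n → ℝ) (ξ : Fin n → EuclideanSpace ℝ (Fin d))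
    (q : Fin m → ℝ) (ζ : Fin m → EuclideanSpace ℝ (Fin d)) : Set ℝ :=
  {t | ∃ π : Matrix (Fin n) (Fin m) ℝ,
    (∀ i j, 0 ≤ π i j) ∧ (∀ i, ∑ j, π i j = p i) ∧ (∀ j, ∑ i, π i j = q j) ∧
      t = ∑ i, ∑ j, π i j * ‖ξ i - ζ j‖ ^ l}

/-- The type-`l` Wasserstein distance between `∑ i, p i • δ_(ξ i)` and `∑ j, q j • δ_(ζ j)`. -/
noncomputable def wassersteinDist {d n m : ℕ} (l : ℝ)
    (p : Fin n → ℝ) (ξ : Fin n → EuclideanSpace ℝ (Fin d))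
    (q : Fin m → ℝ) (ζ : Fin m → EuclideanSpace ℝ (Fin d)) : ℝ :=
  sInf (transportCosts l p ξ q ζ) ^ (1 / l)

/-- The optimal value of the continuous scenario reduction problem: the smallest type-`l`
Wasserstein distance of `∑ i, p i • δ_(ξ i)` to a probability distribution supported on at most
`m` points of `ℝ^d`. Such a distribution is `∑ j, q j • δ_(ζ j)` with `q` in the standard simplex;
the points `ζ j` may coincide and the weights `q j` may vanish. -/
noncomputable def continuousReduction {d n : ℕ} (l : ℝ)
    (p : Fin n → ℝ) (ξ : Fin n → EuclideanSpace ℝ (Fin d)) (m : ℕ) : ℝ :=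
  sInf {r | ∃ q ∈ stdSimplex ℝ (Fin m), ∃ ζ : Fin m → EuclideanSpace ℝ (Fin d),
    r = wassersteinDist l p ξ q ζ}

/-- `C_l` of the empirical distribution `(1 / n) ∑ i, δ_(ξ i)` for reduction to `m` points. -/
noncomputable def empiricalReduction {d n : ℕ} (l : ℝ)
    (ξ : Fin n → EuclideanSpace ℝ (Fin d)) (m : ℕ) : ℝ :=
  continuousReduction l (fun _ => 1 / (n : ℝ)) ξ m

open scoped RealInnerProductSpace

/-! ### Deterministic lower bound for separated points -/

section Reduction

variable {E : Type*} [NormedAddCommGroup E] [InnerProductSpace ℝ E]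

/-! In high dimension the samples are, with high probability, nearly orthogonal with norms just
below 1, so all squared pairwise distances are at least `2 * s` with `s` close to 1.

For such points reduction is expensive. The mass sent to one target costs at least `s` times its
excess over the mass `1 / n` of one atom (`mul_sub_le_sum_mul_norm_sub_sq`); summing over the `m`
targets gives `s * (1 - m / n)`. Near-orthogonality and norm control follow from Chebyshev's
inequality and a union bound (`pi_gaussian_compl_le`), whose failure bound is of order `1 / d` when
`σ ^ 2` is of order `1 / d`. -/

lemma sum_mul_mul_norm_sub_sq_le {ι : Type*} [Fintype ι] (w : ι → ℝ) (x : ι → E) (z : E) :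
    ∑ i, ∑ j, w i * w j * ‖x i - x j‖ ^ 2 ≤ 2 * ((∑ i, w i) * ∑ i, w i * ‖x i - z‖ ^ 2) := by
  have key : ∑ i, ∑ j, w i * w j * ‖x i - x j‖ ^ 2 =
      2 * ((∑ i, w i) * ∑ i, w i * ‖x i - z‖ ^ 2) - 2 * ‖∑ i, w i • (x i - z)‖ ^ 2 := by
    have h (i j : ι) : w i * w j * ‖x i - x j‖ ^ 2 = w i * (w j * ‖x j - z‖ ^ 2)
        + w j * (w i * ‖x i - z‖ ^ 2) - 2 * ⟪w i • (x i - z), w j • (x j - z)⟫ := by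
      rw [← sub_sub_sub_cancel_right (x i) (x j) z, norm_sub_sq_real, real_inner_smul_left,
        real_inner_smul_right]
      ring
    have h1 : ∑ i, ∑ j, w i * (w j * ‖x j - z‖ ^ 2) = (∑ i, w i) * ∑ i, w i * ‖x i - z‖ ^ 2 := by
      rw [Finset.sum_mul_sum]
    have h2 : ∑ i, ∑ j, w j * (w i * ‖x i - z‖ ^ 2) = (∑ i, w i) * ∑ i, w i * ‖x i - z‖ ^ 2 := by
      rw [Finset.sum_comm, Finset.sum_mul_sum]
    simp_rw [h, Finset.sum_sub_distrib, Finset.sum_add_distrib, ← Finset.mul_sum]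
    rw [← real_inner_self_eq_norm_sq, sum_inner]
    simp_rw [inner_sum]
    simp_rw [← Finset.mul_sum] at h1
    simp_rw [← Finset.sum_mul, ← Finset.mul_sum]
    ring
  rw [key]
  nlinarith [sq_nonneg ‖∑ i, w i • (x i - z)‖]

/-- With `W = ∑ i, w i`, separation bounds the weighted pairwise sum below by `2 * s * (W ^ 2 - ∑ i,
w i ^ 2)`, and `∑ i, w i ^ 2 ≤ b * W`. The previous lemma bounds it above by `2 * W` times the cost;
divide by `2 * W`. -/
lemma mul_sub_le_sum_mul_norm_sub_sq {ι : Type*} [Fintype ι] {w : ι → ℝ} {x : ι → E} (z : E)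
    {b s : ℝ} (hw : ∀ i, 0 ≤ w i) (hb : 0 ≤ b) (hwb : ∀ i, w i ≤ b) (hs : 0 ≤ s)
    (hx : ∀ i j, i ≠ j → 2 * s ≤ ‖x i - x j‖ ^ 2) :
    s * (∑ i, w i - b) ≤ ∑ i, w i * ‖x i - z‖ ^ 2 := by
  classical
  have hcost : 0 ≤ ∑ i, w i * ‖x i - z‖ ^ 2 :=
    Finset.sum_nonneg fun i _ => mul_nonneg (hw i) (sq_nonneg _)
  rcases (Finset.sum_nonneg fun i _ => hw i : 0 ≤ ∑ i, w i).eq_or_lt' with hq | hq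
  · rw [hq]
    nlinarith
  have h1 : ∑ i, ∑ j, (w i * w j * (2 * s) - if i = j then w i * w j * (2 * s) else 0) ≤
      ∑ i, ∑ j, w i * w j * ‖x i - x j‖ ^ 2 := by
    refine Finset.sum_le_sum fun i _ => Finset.sum_le_sum fun j _ => ?_
    have := mul_nonneg (hw i) (hw j)
    split_ifs with hij
    · rw [sub_self]
      positivity
    · rw [sub_zero]
      exact mul_le_mul_of_nonneg_left (hx i j hij) this
  have h2 : ∑ i, ∑ j, (w i * w j * (2 * s) - if i = j then w i * w j * (2 * s) else 0) =
      2 * s * ((∑ i, w i) * (∑ i, w i) - ∑ i, w i * w i) := by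
    simp only [Finset.sum_sub_distrib, Finset.sum_ite_eq, Finset.mem_univ, if_true,
      ← Finset.sum_mul, ← Finset.mul_sum]
    ring
  have h3 : ∑ i, w i * w i ≤ b * ∑ i, w i := by
    rw [Finset.mul_sum]
    exact Finset.sum_le_sum fun i _ => mul_le_mul_of_nonneg_right (hwb i) (hw i)
  have h4 := sum_mul_mul_norm_sub_sq_le w x z
  have h5 := mul_le_mul_of_nonneg_left h3 hs
  refine le_of_mul_le_mul_left ?_ hq
  nlinarith

end Reduction

lemma le_transportCosts_two {d n m : ℕ} {q : Fin m → ℝ} {ζ : Fin m → EuclideanSpace ℝ (Fin d)}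
    {ξ : Fin n → EuclideanSpace ℝ (Fin d)} {s t : ℝ} (hn : 1 ≤ n) (hs : 0 ≤ s)
    (hξ : ∀ i j, i ≠ j → 2 * s ≤ ‖ξ i - ξ j‖ ^ 2)
    (ht : t ∈ transportCosts 2 (fun _ => 1 / (n : ℝ)) ξ q ζ) :
    s * (1 - (m : ℝ) / n) ≤ t := by
  obtain ⟨π, hπ, hrow, -, rfl⟩ := ht
  have hn' : (n : ℝ) ≠ 0 := by positivity
  have hle (i : Fin n) (j : Fin m) : π i j ≤ 1 / (n : ℝ) := by
    refine le_of_le_of_eq ?_ (hrow i)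
    exact Finset.single_le_sum (fun j _ => hπ i j) (Finset.mem_univ j)
  have htot : ∑ j, ∑ i, π i j = 1 := by
    rw [Finset.sum_comm]
    simp [hrow, hn']
  calc s * (1 - (m : ℝ) / n) = ∑ j, s * (∑ i, π i j - 1 / (n : ℝ)) := by
        rw [← Finset.mul_sum, Finset.sum_sub_distrib, htot]
        simp [div_eq_mul_inv]
    _ ≤ ∑ j, ∑ i, π i j * ‖ξ i - ζ j‖ ^ 2 := Finset.sum_le_sum fun j _ =>
        mul_sub_le_sum_mul_norm_sub_sq (ζ j) (fun i => hπ i j) (by positivity)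
          (fun i => hle i j) hs hξ
    _ = _ := by
        rw [Finset.sum_comm]
        simp

lemma sqrt_le_empiricalReduction_two {d n m : ℕ} {ξ : Fin n → EuclideanSpace ℝ (Fin d)} {s : ℝ}
    (hm : 1 ≤ m) (hn : 1 ≤ n) (hs : 0 ≤ s) (hξ : ∀ i j, i ≠ j → 2 * s ≤ ‖ξ i - ξ j‖ ^ 2) :
    √(s * (1 - (m : ℝ) / n)) ≤ empiricalReduction 2 ξ m := by
  have hn' : (n : ℝ) ≠ 0 := by positivity
  refine le_csInf ?_ ?_
  -- Nonemptiness matters, since the real `sInf ∅` is 0; this is where `1 ≤ m` enters.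
  · exact ⟨_, Pi.single ⟨0, hm⟩ 1, single_mem_stdSimplex ℝ _, fun _ => 0, rfl⟩
  · rintro _ ⟨q, hq, ζ, rfl⟩
    rw [wassersteinDist, ← Real.sqrt_eq_rpow]
    refine Real.sqrt_le_sqrt (le_csInf ?_ fun t ht => le_transportCosts_two hn hs hξ ht)
    -- The product coupling is always a feasible plan.
    refine ⟨_, fun _ j => 1 / (n : ℝ) * q j, fun i j => ?_, fun i => ?_, fun j => ?_, rfl⟩
    · exact mul_nonneg (by positivity) (hq.1 j)
    · rw [← Finset.mul_sum, hq.2, mul_one]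
    · simp [hn']

/-! ### Concentration of norms and inner products -/

section Gaussian

lemma posSemidef_sq_smul_one {ι : Type*} [DecidableEq ι] (σ : ℝ) :
    (σ ^ 2 • (1 : Matrix ι ι ℝ)).PosSemidef :=
  Matrix.PosSemidef.one.smul (sq_nonneg σ)

variable {ι : Type*} [Fintype ι]

lemma memLp_sq_gaussianReal : MemLp (fun x : ℝ => x ^ 2) 2 (gaussianReal 0 1) := by
  have h := (memLp_id_gaussianReal (μ := 0) (v := 1) 4).integrable_norm_pow (p := 4) (by norm_num)
  rw [memLp_two_iff_integrable_sq (by fun_prop)]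
  refine h.congr (Filter.Eventually.of_forall fun x => ?_)
  simp [← pow_mul, Even.pow_abs (by decide : Even 4)]

lemma integral_sq_gaussianReal : ∫ x : ℝ, x ^ 2 ∂gaussianReal 0 1 = 1 := by
  have := variance_fun_id_gaussianReal (μ := 0) (v := 1)
  rw [variance_of_integral_eq_zero (by fun_prop) (by simp)] at this
  simpa using this

lemma norm_sq_smul_toLp (σ : ℝ) (x : ι → ℝ) :
    ‖σ • WithLp.toLp 2 x‖ ^ 2 = ∑ i, σ ^ 2 * x i ^ 2 := by
  rw [norm_smul, mul_pow, EuclideanSpace.real_norm_sq_eq, Finset.mul_sum]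
  simp

lemma integrable_sq_smul_eval (σ : ℝ) (i : ι) :
    Integrable (fun x : ι → ℝ => σ ^ 2 * x i ^ 2) (Measure.pi fun _ : ι => gaussianReal 0 1) :=
  ((measurePreserving_eval (fun _ : ι => gaussianReal 0 1) i).integrable_comp_of_integrable
    (memLp_sq_gaussianReal.integrable one_le_two)).const_mul (σ ^ 2)

lemma integral_sum_sq_pi_gaussianReal (σ : ℝ) :
    ∫ x : ι → ℝ, ∑ i, σ ^ 2 * x i ^ 2 ∂(Measure.pi fun _ : ι => gaussianReal 0 1) =
      Fintype.card ι * σ ^ 2 := by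
  rw [integral_finsetSum _ fun i _ => integrable_sq_smul_eval σ i]
  have (i : ι) : ∫ x : ι → ℝ, σ ^ 2 * x i ^ 2 ∂(Measure.pi fun _ : ι => gaussianReal 0 1) =
      σ ^ 2 := by
    rw [integral_const_mul, integral_comp_eval (μ := fun _ : ι => gaussianReal 0 1) (i := i)
      (f := fun y : ℝ => y ^ 2) (by fun_prop), integral_sq_gaussianReal, mul_one]
  simp [this]

variable [DecidableEq ι]

lemma multivariateGaussian_zero_sq_smul_one (σ : ℝ) :
    multivariateGaussian (0 : EuclideanSpace ℝ ι) (σ ^ 2 • (1 : Matrix ι ι ℝ)) =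
      (Measure.pi fun _ : ι => gaussianReal 0 1).map (fun x => σ • WithLp.toLp 2 x) := by
  have h : (fun x : ι → ℝ => σ • WithLp.toLp 2 x) =
      (fun y : EuclideanSpace ℝ ι => σ • y) ∘ WithLp.toLp 2 := rfl
  rw [h, ← Measure.map_map (by fun_prop) (by fun_prop), map_pi_eq_stdGaussian]
  apply Measure.ext_of_charFun
  ext t
  rw [charFun_multivariateGaussian (posSemidef_sq_smul_one σ), charFun_map_smul,
    charFun_stdGaussian]
  congr 1
  have : (t.ofLp ⬝ᵥ (σ ^ 2 • (1 : Matrix ι ι ℝ)).mulVec t.ofLp) = ‖σ • t‖ ^ 2 := by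
    rw [norm_smul, mul_pow, EuclideanSpace.real_norm_sq_eq, Matrix.smul_mulVec, Matrix.one_mulVec,
      dotProduct_smul, dotProduct]
    simp [pow_two]
  rw [this]
  push_cast
  simp
  ring

lemma measure_le_abs_norm_sq_sub_le (σ : ℝ) {t : ℝ} (ht : 0 < t) :
    multivariateGaussian (0 : EuclideanSpace ℝ ι) (σ ^ 2 • (1 : Matrix ι ι ℝ))
      {x | t ≤ |‖x‖ ^ 2 - Fintype.card ι * σ ^ 2|} ≤
      ENNReal.ofReal
        (Fintype.card ι * σ ^ 4 * Var[fun x => x ^ 2; gaussianReal 0 1] / t ^ 2) := by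
  have hmem (i : ι) : MemLp (fun x : ℝ => σ ^ 2 * x ^ 2) 2 (gaussianReal 0 1) :=
    memLp_sq_gaussianReal.const_mul _
  have hvar : Var[fun x : ι → ℝ => ∑ i, σ ^ 2 * x i ^ 2;
      Measure.pi fun _ : ι => gaussianReal 0 1] =
      Fintype.card ι * σ ^ 4 * Var[fun x => x ^ 2; gaussianReal 0 1] := by
    have := variance_sum_pi (μ := fun _ : ι => gaussianReal 0 1) hmem
    rw [show (∑ i, fun x : ι → ℝ => σ ^ 2 * x i ^ 2) = fun x => ∑ i, σ ^ 2 * x i ^ 2 from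
      Finset.sum_fn _ _] at this
    rw [this]
    simp [variance_const_mul]
    ring
  have hL : MemLp (fun x : ι → ℝ => ∑ i, σ ^ 2 * x i ^ 2) 2
      (Measure.pi fun _ : ι => gaussianReal 0 1) :=
    memLp_finsetSum _ fun i _ => (hmem i).comp_measurePreserving
      (measurePreserving_eval (fun _ : ι => gaussianReal 0 1) i)
  have := meas_ge_le_variance_div_sq hL ht
  rw [hvar, integral_sum_sq_pi_gaussianReal] at this
  rw [multivariateGaussian_zero_sq_smul_one, Measure.map_apply (by fun_prop)
    (measurableSet_le (by fun_prop) (by fun_prop))]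
  simpa only [Set.preimage_ofPred_eq, norm_sq_smul_toLp] using this

lemma integrable_norm_sq_multivariateGaussian {S : Matrix ι ι ℝ} :
    Integrable (fun x => ‖x‖ ^ 2) (multivariateGaussian (0 : EuclideanSpace ℝ ι) S) :=
  IsGaussian.memLp_two_id.integrable_norm_pow two_ne_zero

lemma integral_norm_sq_multivariateGaussian (σ : ℝ) :
    ∫ x, ‖x‖ ^ 2 ∂(multivariateGaussian (0 : EuclideanSpace ℝ ι) (σ ^ 2 • (1 : Matrix ι ι ℝ))) =
      Fintype.card ι * σ ^ 2 := by
  rw [multivariateGaussian_zero_sq_smul_one, integral_map (by fun_prop) (by fun_prop)]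
  simp_rw [norm_sq_smul_toLp]
  exact integral_sum_sq_pi_gaussianReal σ

lemma measure_le_abs_inner_le (σ : ℝ) {t : ℝ} (ht : 0 < t) (x : EuclideanSpace ℝ ι) :
    multivariateGaussian (0 : EuclideanSpace ℝ ι) (σ ^ 2 • (1 : Matrix ι ι ℝ))
      {y | t ≤ |⟪x, y⟫|} ≤ ENNReal.ofReal (σ ^ 2 / t ^ 2 * ‖x‖ ^ 2) := by
  set γ := multivariateGaussian (0 : EuclideanSpace ℝ ι) (σ ^ 2 • (1 : Matrix ι ι ℝ)) with hγ
  have hL : MemLp (fun y => ⟪x, y⟫) 2 γ := by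
    simpa using (innerSL ℝ x).comp_memLp' (IsGaussian.memLp_two_id (μ := γ))
  have hmean : ∫ y, ⟪x, y⟫ ∂γ = 0 := by
    rw [integral_inner IsGaussian.integrable_fun_id, integral_id_multivariateGaussian,
      inner_zero_right]
  have hvar : Var[fun y => ⟪x, y⟫; γ] = σ ^ 2 * ‖x‖ ^ 2 := by
    rw [← covarianceBilin_self IsGaussian.memLp_two_id,
      covarianceBilin_multivariateGaussian (posSemidef_sq_smul_one σ), Matrix.smul_mulVec,
      Matrix.one_mulVec, dotProduct_smul, dotProduct, EuclideanSpace.real_norm_sq_eq]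
    simp [pow_two]
  have := meas_ge_le_variance_div_sq hL ht
  rw [hmean, hvar] at this
  simp only [sub_zero] at this
  rwa [div_mul_eq_mul_div]

/-- Fix the first vector `x`, apply Chebyshev to the second (variance `σ ^ 2 * ‖x‖ ^ 2`), then
integrate over `x`. -/
lemma prod_measure_le_abs_inner_le (σ : ℝ) {t : ℝ} (ht : 0 < t) :
    ((multivariateGaussian (0 : EuclideanSpace ℝ ι) (σ ^ 2 • (1 : Matrix ι ι ℝ))).prod
      (multivariateGaussian (0 : EuclideanSpace ℝ ι) (σ ^ 2 • (1 : Matrix ι ι ℝ))))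
      {p | t ≤ |⟪p.1, p.2⟫|} ≤ ENNReal.ofReal (Fintype.card ι * σ ^ 4 / t ^ 2) := by
  rw [Measure.prod_apply (measurableSet_le (by fun_prop) (by fun_prop))]
  refine (lintegral_mono fun x => measure_le_abs_inner_le σ ht x).trans ?_
  rw [← ofReal_integral_eq_lintegral_ofReal
    (integrable_norm_sq_multivariateGaussian.const_mul _)
    (Filter.Eventually.of_forall fun x => by positivity), integral_const_mul,
    integral_norm_sq_multivariateGaussian]
  refine ENNReal.ofReal_le_ofReal (le_of_eq ?_)
  ring

end Gaussian

/-! ### The good event for the whole sample -/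

lemma map_eval_pair_pi {α : Type*} [MeasurableSpace α] {n : ℕ} (μ : Measure α)
    [IsProbabilityMeasure μ] {i j : Fin n} (hij : i ≠ j) :
    (Measure.pi fun _ : Fin n => μ).map (fun x => (x i, x j)) = μ.prod μ := by
  have h : iIndepFun (fun (i : Fin n) (x : Fin n → α) => x i) (Measure.pi fun _ => μ) :=
    iIndepFun_pi (X := fun _ => id) fun _ => aemeasurable_id
  rw [(indepFun_iff_map_prod_eq_prod_map_map (measurable_pi_apply i).aemeasurable
    (measurable_pi_apply j).aemeasurable).1 (h.indepFun hij),
    (measurePreserving_eval (fun _ : Fin n => μ) i).map_eq,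
    (measurePreserving_eval (fun _ : Fin n => μ) j).map_eq]

lemma pi_gaussian_compl_le {d n : ℕ} (σ : ℝ) {t : ℝ} (ht : 0 < t) :
    (Measure.pi (fun _ : Fin n => multivariateGaussian (0 : EuclideanSpace ℝ (Fin d))
      (σ ^ 2 • (1 : Matrix (Fin d) (Fin d) ℝ))))
      {ξ | (∀ i, |‖ξ i‖ ^ 2 - d * σ ^ 2| < t) ∧ ∀ i j, i ≠ j → |⟪ξ i, ξ j⟫| < t}ᶜ ≤
      ENNReal.ofReal ((n * Var[fun x => x ^ 2; gaussianReal 0 1] + n ^ 2) *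
        (d * σ ^ 4 / t ^ 2)) := by
  set γ := multivariateGaussian (0 : EuclideanSpace ℝ (Fin d))
    (σ ^ 2 • (1 : Matrix (Fin d) (Fin d) ℝ))
  set P := Measure.pi (fun _ : Fin n => γ)
  set v := Var[fun x => x ^ 2; gaussianReal 0 1]
  have hv : 0 ≤ v := variance_nonneg _ _
  have hA (i : Fin n) : P {ξ | t ≤ |‖ξ i‖ ^ 2 - d * σ ^ 2|} ≤
      ENNReal.ofReal (d * σ ^ 4 * v / t ^ 2) := by
    have h := measure_le_abs_norm_sq_sub_le (ι := Fin d) σ ht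
    rw [Fintype.card_fin] at h
    refine le_trans (le_of_eq ?_) h
    exact (measurePreserving_eval (fun _ : Fin n => γ) i).measure_preimage
      (measurableSet_le (f := fun _ : EuclideanSpace ℝ (Fin d) => t)
        (g := fun x => |‖x‖ ^ 2 - d * σ ^ 2|) (by fun_prop) (by fun_prop)).nullMeasurableSet
  have hB (i j : Fin n) : P {ξ | i ≠ j ∧ t ≤ |⟪ξ i, ξ j⟫|} ≤
      ENNReal.ofReal (d * σ ^ 4 / t ^ 2) := by
    by_cases hij : i = j
    · simp [hij]
    have h := prod_measure_le_abs_inner_le (ι := Fin d) σ ht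
    rw [Fintype.card_fin, ← map_eval_pair_pi _ hij, Measure.map_apply (by fun_prop)
      (measurableSet_le (by fun_prop) (by fun_prop))] at h
    simpa [hij] using h
  have hsub : {ξ : Fin n → EuclideanSpace ℝ (Fin d) | (∀ i, |‖ξ i‖ ^ 2 - d * σ ^ 2| < t) ∧
      ∀ i j, i ≠ j → |⟪ξ i, ξ j⟫| < t}ᶜ ⊆
      (⋃ i, {ξ | t ≤ |‖ξ i‖ ^ 2 - d * σ ^ 2|}) ∪
        ⋃ i, ⋃ j, {ξ | i ≠ j ∧ t ≤ |⟪ξ i, ξ j⟫|} := by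
    intro ξ hξ
    simp only [Set.mem_compl_iff, Set.mem_ofPred_eq, not_and_or, not_forall, not_lt] at hξ
    simp only [Set.mem_union, Set.mem_iUnion, Set.mem_ofPred_eq]
    rcases hξ with h | ⟨i, j, hij, h⟩
    · exact Or.inl h
    · exact Or.inr ⟨i, j, hij, h⟩
  calc _ ≤ _ := measure_mono hsub
    _ ≤ _ := measure_union_le _ _
    _ ≤ ∑ i, P {ξ | t ≤ |‖ξ i‖ ^ 2 - d * σ ^ 2|} +
        ∑ i, ∑ j, P {ξ | i ≠ j ∧ t ≤ |⟪ξ i, ξ j⟫|} := by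
      refine add_le_add (measure_iUnion_fintype_le _ _) ?_
      exact (measure_iUnion_fintype_le _ _).trans
        (Finset.sum_le_sum fun i _ => measure_iUnion_fintype_le _ _)
    _ ≤ ∑ _i : Fin n, ENNReal.ofReal (d * σ ^ 4 * v / t ^ 2) +
        ∑ _i : Fin n, ∑ _j : Fin n, ENNReal.ofReal (d * σ ^ 4 / t ^ 2) := by
      gcongr with i _ i _ j _
      · exact hA i
      · exact hB i j
    _ = _ := by
      rw [← ENNReal.ofReal_sum_of_nonneg fun i _ => by positivity]
      simp_rw [← ENNReal.ofReal_sum_of_nonneg (f := fun _ : Fin n => (d * σ ^ 4 / t ^ 2 : ℝ))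
        (s := Finset.univ) fun i _ => by positivity]
      rw [← ENNReal.ofReal_sum_of_nonneg fun i _ => by positivity, ← ENNReal.ofReal_add
        (by positivity) (by positivity)]
      congr 1
      simp only [Finset.sum_const, Finset.card_univ, Fintype.card_fin, nsmul_eq_mul]
      ring

/-! ### Choice of parameters and conclusion -/

lemma sqrt_sub_le_sqrt_mul {δ s x : ℝ} (hx1 : x ≤ 1) (hδ : 0 ≤ δ)
    (hs : (1 - δ) ^ 2 ≤ s) : √x - δ ≤ √(s * x) := by
  have hs' : 1 - δ ≤ √s := Real.le_sqrt_of_sq_le hs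
  have hx' : √x ≤ 1 := Real.sqrt_le_one.2 hx1
  rw [Real.sqrt_mul ((sq_nonneg _).trans hs)]
  nlinarith [Real.sqrt_nonneg x, mul_le_mul_of_nonneg_right hs' (Real.sqrt_nonneg x)]

theorem proposition3 (n m : ℕ) (hm : 1 ≤ m) (hmn : m ≤ n) (ε δ : ℝ) (hε : 0 < ε) (hδ : 0 < δ) :
    ∃ c : ℝ, 0 < c ∧ ∃ d : ℕ, 1 ≤ d ∧
      1 - ε ≤
        (Measure.pi (fun _ : Fin n =>
          multivariateGaussian (0 : EuclideanSpace ℝ (Fin d))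
            ((√((d : ℝ) - 1) + c) ^ (-2 : ℤ) • (1 : Matrix (Fin d) (Fin d) ℝ)))).real
          {ξ : Fin n → EuclideanSpace ℝ (Fin d) |
            (∀ i, ‖ξ i‖ ≤ 1) ∧
              √(1 - (m : ℝ) / (n : ℝ)) - δ ≤ empiricalReduction 2 ξ m} := by
  obtain ⟨δ', hδ'0, hδ'1, hδ'δ⟩ : ∃ δ' : ℝ, 0 < δ' ∧ δ' ≤ 1 ∧ δ' ≤ δ :=
    ⟨min δ 1, lt_min hδ one_pos, min_le_right _ _, min_le_left _ _⟩
  set v := Var[fun x => x ^ 2; gaussianReal 0 1]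
  have hv : 0 ≤ v := variance_nonneg _ _
  have hn : 1 ≤ n := hm.trans hmn
  set t := δ' / 8 with ht_def
  have ht : 0 < t := by positivity
  set r := 1 - δ' / 2 with hr_def
  have hr : 0 < r := by linarith
  have hr1 : r < 1 := by linarith
  -- The three bounds give `r ^ 2 / k ≤ t`, `k + 1 ≤ 2 * k`, and failure probability at most `ε`.
  obtain ⟨k, hk⟩ := exists_nat_ge (max (1 / t) (max 1 (2 * (n * v + n ^ 2) / (t ^ 2 * ε))))
  simp only [max_le_iff] at hk
  obtain ⟨hkt, hk1, hkε⟩ := hk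
  have hk0 : (0 : ℝ) < k := by linarith
  have hsk : 0 < √(k : ℝ) := Real.sqrt_pos.2 hk0
  set σ := r / √(k : ℝ) with hσ
  have hσ2 : σ ^ 2 = r ^ 2 / k := by rw [hσ, div_pow, Real.sq_sqrt hk0.le]
  -- With `d = k + 1`, this `c` makes `√(d - 1) + c = √k / r = 1 / σ`.
  refine ⟨(1 / r - 1) * √(k : ℝ), mul_pos (sub_pos.2 ((one_lt_div hr).2 hr1)) hsk, k + 1,
    by omega, ?_⟩
  have hcov : (√(((k + 1 : ℕ) : ℝ) - 1) + (1 / r - 1) * √(k : ℝ)) ^ (-2 : ℤ) = σ ^ 2 := by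
    rw [Nat.cast_add_one, add_sub_cancel_right, hσ, zpow_neg, zpow_ofNat, ← inv_pow]
    congr 1
    field_simp
    ring
  rw [hcov]
  have hvar : ((k + 1 : ℕ) : ℝ) * σ ^ 2 = r ^ 2 + r ^ 2 / k := by
    rw [hσ2]
    push_cast
    field_simp
  have hkt' : r ^ 2 / k ≤ t := by
    rw [div_le_iff₀ hk0]
    rw [div_le_iff₀ ht] at hkt
    nlinarith
  have hpos : 0 ≤ r ^ 2 / k := by positivity
  have hprob := pi_gaussian_compl_le (d := k + 1) (n := n) σ ht
  have hbound : (n * v + n ^ 2) * (((k + 1 : ℕ) : ℝ) * σ ^ 4 / t ^ 2) ≤ ε := by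
    have h4 : ((k + 1 : ℕ) : ℝ) * σ ^ 4 ≤ 2 / k := by
      have hr2 : r ^ 2 ≤ 1 := by nlinarith
      have hr4 : r ^ 4 ≤ 1 := by nlinarith [sq_nonneg r]
      rw [show σ ^ 4 = r ^ 4 / k ^ 2 by rw [show σ ^ 4 = (σ ^ 2) ^ 2 by ring, hσ2]; ring]
      push_cast
      rw [mul_div_assoc', div_le_div_iff₀ (by positivity) hk0]
      nlinarith [mul_le_mul_of_nonneg_left hr4 (by positivity : (0 : ℝ) ≤ (k + 1) * k)]
    rw [div_le_iff₀ (by positivity)] at hkε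
    calc (n * v + n ^ 2) * (((k + 1 : ℕ) : ℝ) * σ ^ 4 / t ^ 2)
        ≤ (n * v + n ^ 2) * (2 / k / t ^ 2) := by gcongr
      _ = 2 * (n * v + n ^ 2) / (k * t ^ 2) := by field_simp
      _ ≤ ε := by
        rw [div_le_iff₀ (by positivity)]
        linarith
  set P := Measure.pi (fun _ : Fin n => multivariateGaussian
    (0 : EuclideanSpace ℝ (Fin (k + 1))) (σ ^ 2 • (1 : Matrix (Fin (k + 1)) (Fin (k + 1)) ℝ)))
  set G := {ξ : Fin n → EuclideanSpace ℝ (Fin (k + 1)) |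
    (∀ i, |‖ξ i‖ ^ 2 - ((k + 1 : ℕ) : ℝ) * σ ^ 2| < t) ∧ ∀ i j, i ≠ j → |⟪ξ i, ξ j⟫| < t}
  have hGc : P.real Gᶜ ≤ ε :=
    ENNReal.toReal_le_of_le_ofReal hε.le (hprob.trans (ENNReal.ofReal_le_ofReal hbound))
  have hG : 1 - ε ≤ P.real G := by
    have := measureReal_union_le (μ := P) G Gᶜ
    rw [Set.union_compl_self, probReal_univ] at this
    linarith
  -- Monotonicity requires no measurability of the target event.
  refine hG.trans (measureReal_mono ?_)
  rintro ξ ⟨h1, h2⟩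
  simp_rw [hvar, abs_lt] at h1
  refine ⟨fun i => ?_, ?_⟩
  · have := (h1 i).2
    rw [← sq_le_one_iff₀ (norm_nonneg _)]
    nlinarith
  -- One `t` is lost to the norms and one to the inner product.
  · set s := r ^ 2 - 2 * t with hs_def
    have hs : (1 - δ') ^ 2 ≤ s := by
      rw [hs_def, hr_def, ht_def]
      nlinarith
    have hs0 : 0 ≤ s := (sq_nonneg _).trans hs
    have hmn' : (m : ℝ) / n ≤ 1 := div_le_one_of_le₀ (by exact_mod_cast hmn) (by positivity)
    have hmn0 : 0 ≤ (m : ℝ) / n := by positivity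
    have hsqrt := sqrt_sub_le_sqrt_mul (x := 1 - (m : ℝ) / n) (by linarith) hδ'0.le hs
    have hred := sqrt_le_empiricalReduction_two (ξ := ξ) hm hn hs0 fun i j hij => by
      rw [norm_sub_sq_real]
      have := (h1 i).1
      have := (h1 j).1
      have := (abs_lt.1 (h2 i j hij)).2
      linarith
    linarith
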